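/- Let $A=S^1\times[0,1]$ with $S^1=\mathbb R/\mathbb Z$, let $\tilde A=\mathbb R\times[0,1]$ be its universal cover, with covering map $p:\tilde A\to A$, and let $p_1:\tilde A\to\mathbb R$ be the projection on the first coordinate. Let $f:A\to A$ be a homeomorphism that preserves orientation and each of the two boundary components, and let $\tilde f:\tilde A\to\tilde A$ be a lift of $f$ (a homeomorphism with $p\circ\tilde f=f\circ p$; it then satisfies $\tilde f(\tilde x+1,\tilde y)=\tilde f(\tilde x,\tilde y)+(1,0)$) which has a dense orbit in $\tilde A$. Suppose that for $i=0,1$ the rotation number $\lim_{n\to\infty}\big(p_1(\tilde f^n(\tilde x,i))-\tilde x\big)/n$ of $\tilde f$ restricted to $\mathbb R\times\{i\}$ is strictly positive. Put $$B=\bigcap_{n\le 0}\tilde f^n\big(]-\infty,0]\times[0,1]\big),$$ and let $B^-$ be the union of all unbounded connected components of $B$. Then there is a real number $\rho^+(B^-)<0$ such that for every $\tilde z\in B^-$ $$\limsup_{n\to\infty}\frac{p_1(\tilde f^n(\tilde z))-p_1(\tilde z)}{n}\le\rho^+(B^-)<0.$$ -/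

import Mathlib

open Filter Topology

namespace AnnulusLift

/-- The closed annulus `A = S¹ × [0,1]`, with `S¹ = ℝ/ℤ`. -/
abbrev Annulus : Type := UnitAddCircle × unitInterval

/-- The infinite strip `Ã = ℝ × [0,1]`, the universal cover of the annulus. -/
abbrev Strip : Type := ℝ × unitInterval

/-- The covering map `p : Ã → A`. -/
def proj (z : Strip) : Annulus := ((z.1 : UnitAddCircle), z.2)

/-- The deck translation `(x, y) ↦ (x, y) + (1, 0)` of the strip. -/
def translate (z : Strip) : Strip := (z.1 + 1, z.2)

/-- `F` is a lift of `f` to the strip: `p ∘ F = f ∘ p`. -/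
def IsLift (f : Annulus ≃ₜ Annulus) (F : Strip ≃ₜ Strip) : Prop :=
  ∀ z : Strip, proj (F z) = f (proj z)

/-- `f` maps each of the two boundary circles `S¹ × {0}` and `S¹ × {1}` onto itself. -/
def PreservesBoundaryComponents (f : Annulus ≃ₜ Annulus) : Prop :=
  f '' {z : Annulus | z.2 = 0} = {z : Annulus | z.2 = 0} ∧
    f '' {z : Annulus | z.2 = 1} = {z : Annulus | z.2 = 1}

/-- Orientation preservation, for a homeomorphism of the annulus that preserves both boundary
components: `f` acts trivially on the fundamental group `ℤ` of the annulus, which means that the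
lifts of `f` commute with the deck translation, `F (x + 1, y) = F (x, y) + (1, 0)`
(for an orientation reversing one, `F (x + 1, y) = F (x, y) - (1, 0)`). -/
def PreservesOrientation (f : Annulus ≃ₜ Annulus) : Prop :=
  ∀ F : Strip ≃ₜ Strip, IsLift f F → ∀ z : Strip, F (translate z) = translate (F z)

/-- A homeomorphism of the strip is transitive if it has a dense (two-sided) orbit. -/
def IsTransitive (F : Strip ≃ₜ Strip) : Prop :=
  ∃ z : Strip, Dense (Set.range fun n : ℤ => (F ^ n) z)

/-- The restriction of `F` to the boundary line `ℝ × {i}` has rotation number `ρ`: for every `x`,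
`(p₁ (Fⁿ (x, i)) - x) / n → ρ`. -/
def HasBoundaryRotationNumber (F : Strip ≃ₜ Strip) (i : unitInterval) (ρ : ℝ) : Prop :=
  ∀ x : ℝ, Tendsto (fun n : ℕ => ((F^[n] (x, i)).1 - x) / (n : ℝ)) atTop (𝓝 ρ)

/-- `V⁻ = ]-∞, 0] × [0,1]`. -/
def leftHalf : Set Strip := {z | z.1 ≤ 0}

/-- `B = ⋂_{n ≤ 0} Fⁿ(V⁻)`. For `n = -m` with `m ≥ 0`, the image `Fⁿ(V⁻)` is the preimage
of `V⁻` under `Fᵐ`. -/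
def setB (F : Strip ≃ₜ Strip) : Set Strip := ⋂ m : ℕ, F^[m] ⁻¹' leftHalf

/-- `B⁻`: the union of the unbounded connected components of `B`. -/
def setBminus (F : Strip ≃ₜ Strip) : Set Strip :=
  {z ∈ setB F | ¬ Bornology.IsBounded (connectedComponentIn (setB F) z)}

end AnnulusLift

/-! Everything reduces to finding `N > 0` such that `F^N` carries all of `B⁻` to the left of `-1`.
Then `z ↦ F^N z + (1, 0)` maps `B⁻` into itself, and iterating this map gives a uniform leftward
drift of at least one unit per `N` steps (`fst_iterate_le`).

If no such `N` exists, points of `B⁻` have late images in the compact window `-1 ≤ x ≤ 0`. A cluster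
point of these images lies in an unbounded component of the set `fullB` of points whose whole
two-sided orbit stays in the left half (`not_isBounded_connectedComponentIn_of_mapClusterPt`). The
union `D` of all such components is closed and invariant, consists of connected hairs running to the
left end, and misses both boundary lines, because boundary points drift to the right. This is
`IsHairSet`.

Transitivity excludes such a `D`. On the one hand `D` must approach a boundary line: otherwise the
components of the two lines in the complement of the closure of the integer translates of `D` are
open and invariant, hence meet, and a path across the strip avoids every translate of a hair
(`exists_near_boundary`). On the other hand, some iterate pushes a neighbourhood of that line to the
right; a hair entering this neighbourhood, closed off by a vertical segment, bounds a left region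
that the iterate expands, which produces a wandering open set (`lt_snd`; the top line follows by
reflection). -/

namespace AnnulusLift

/-! ### Planar crossing: Poincaré–Miranda and intersecting paths -/

/-- A continuous angle that starts in `[-π/2, π/2]` and has nonnegative cosine along a segment
stays in `[-π/2, π/2]`. -/
theorem abs_le_pi_div_two_of_cos_nonneg {θ : ℝ → ℝ} (hθ : Continuous θ)
    (hcos : ∀ s, 0 ≤ Real.cos (θ s)) {a b : ℝ} (ha : |θ a| ≤ Real.pi / 2) :
    |θ b| ≤ Real.pi / 2 := by
  have key : ∀ φ : ℝ → ℝ, Continuous φ → (∀ s, 0 ≤ Real.cos (φ s)) → φ a ≤ Real.pi / 2 →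
      φ b ≤ Real.pi / 2 := by
    intro φ hφ hc h
    by_contra! hb
    have hpi := Real.pi_pos
    have hmem : min (φ b) Real.pi ∈ Set.Icc (φ a) (φ b) :=
      ⟨le_min (by linarith) (by linarith), min_le_left _ _⟩
    obtain ⟨s, hs⟩ := mem_range_of_exists_le_of_exists_ge hφ ⟨a, hmem.1⟩ ⟨b, hmem.2⟩
    have h1 : Real.pi / 2 < φ s := by rw [hs]; exact lt_min hb (by linarith)
    have h2 : φ s ≤ Real.pi := by rw [hs]; exact min_le_right _ _
    have := Real.cos_neg_of_pi_div_two_lt_of_lt h1 (by linarith)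
    linarith [hc s]
  rw [abs_le] at ha ⊢
  have h1 := key θ hθ hcos ha.2
  have h2 := key (fun s => -θ s) hθ.neg (fun s => by simpa using hcos s) (by linarith [ha.1])
  exact ⟨by linarith, h1⟩

/-- The two-dimensional Poincaré–Miranda theorem. -/
theorem exists_eq_zero_of_sides {g : ℝ × ℝ → ℂ} (hg : Continuous g)
    (h0 : ∀ t, (g (0, t)).im ≤ 0) (h1 : ∀ t, 0 ≤ (g (1, t)).im)
    (hl : ∀ s, 0 ≤ (g (s, 0)).re) (hr : ∀ s, (g (s, 1)).re ≤ 0) : ∃ p, g p = 0 := by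
  by_contra! hne
  -- A zero-free `g` on the simply connected plane has a continuous logarithm; its imaginary part
  -- `θ` is an angle that can be followed along the sides of the square.
  obtain ⟨ℓ, ⟨hℓ0, hℓ⟩, -⟩ := Complex.isCoveringMap_exp.existsUnique_continuousMap_lifts
    (⟨fun p => ⟨g p, hne p⟩, by fun_prop⟩ : C(ℝ × ℝ, {z : ℂ // z ≠ 0})) (0, 0)
    (Complex.log (g (0, 0))) (by simp [Complex.exp_log (hne _)])
  have hexp : ∀ p, Complex.exp (ℓ p) = g p := fun p => congrArg Subtype.val (congrFun hℓ p)
  set θ : ℝ × ℝ → ℝ := fun p => (ℓ p).im with hθdef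
  have hθ : Continuous θ := Complex.continuous_im.comp ℓ.continuous
  have hre : ∀ p, (g p).re = Real.exp (ℓ p).re * Real.cos (θ p) := fun p => by
    rw [← hexp, Complex.exp_re]
  have him : ∀ p, (g p).im = Real.exp (ℓ p).re * Real.sin (θ p) := fun p => by
    rw [← hexp, Complex.exp_im]
  have hc0 : ∀ s, 0 ≤ Real.cos (θ (s, 0)) := fun s =>
    nonneg_of_mul_nonneg_right ((hre (s, 0)) ▸ hl s) (Real.exp_pos _)
  have hc1 : ∀ s, Real.cos (θ (s, 1)) ≤ 0 := fun s =>
    nonpos_of_mul_nonpos_right ((hre (s, 1)) ▸ hr s) (Real.exp_pos _)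
  have hs0 : ∀ t, Real.sin (θ (0, t)) ≤ 0 := fun t =>
    nonpos_of_mul_nonpos_right ((him (0, t)) ▸ h0 t) (Real.exp_pos _)
  have hs1 : ∀ t, 0 ≤ Real.sin (θ (1, t)) := fun t =>
    nonneg_of_mul_nonneg_right ((him (1, t)) ▸ h1 t) (Real.exp_pos _)
  have hpi := Real.pi_pos
  have hstart : |θ (0, 0)| ≤ Real.pi / 2 := by
    simp only [hθdef, hℓ0, Complex.log_im]
    exact Complex.abs_arg_le_pi_div_two_iff.2 (hl 0)
  have hend : |θ (1, 0)| ≤ Real.pi / 2 :=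
    abs_le_pi_div_two_of_cos_nonneg (θ := fun s => θ (s, 0)) (by fun_prop) hc0 hstart
  rw [abs_le] at hstart hend
  have hstart' : θ (0, 0) ≤ 0 := by
    by_contra! h
    linarith [hs0 0, Real.sin_pos_of_pos_of_lt_pi h (by linarith)]
  have hend' : 0 ≤ θ (1, 0) := by
    by_contra! h
    linarith [hs1 0, Real.sin_neg_of_neg_of_neg_pi_lt h (by linarith)]
  -- The sign of the sine confines `θ` to `[-π, 0]` on the side `s = 0` and to `[0, π]` on the side
  -- `s = 1`. Hence `θ` vanishes somewhere on the side `t = 1`, where its cosine should be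
  -- nonpositive.
  have hA : |θ (0, 1) + Real.pi / 2| ≤ Real.pi / 2 :=
    abs_le_pi_div_two_of_cos_nonneg (θ := fun t => θ (0, t) + Real.pi / 2) (a := 0) (by fun_prop)
      (fun t => by rw [Real.cos_add_pi_div_two]; linarith [hs0 t])
      (abs_le.2 ⟨by linarith, by linarith⟩)
  have hB : |θ (1, 1) - Real.pi / 2| ≤ Real.pi / 2 :=
    abs_le_pi_div_two_of_cos_nonneg (θ := fun t => θ (1, t) - Real.pi / 2) (a := 0) (by fun_prop)
      (fun t => by rw [Real.cos_sub_pi_div_two]; exact hs1 t)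
      (abs_le.2 ⟨by linarith, by linarith⟩)
  rw [abs_le] at hA hB
  obtain ⟨s, hs⟩ := mem_range_of_exists_le_of_exists_ge
    (f := fun s => θ (s, 1)) (c := 0) (by fun_prop) ⟨0, by linarith⟩ ⟨1, by linarith⟩
  have := hc1 s
  simp only at hs
  rw [hs, Real.cos_zero] at this
  linarith

/-- Local path connectedness passes to the quotient of `ℝ` by `projIcc`. It makes connected open
subsets of the strip path connected. -/
instance : LocallyPathConnectedSpace unitInterval :=
  (isQuotientMap_projIcc (h := zero_le_one (α := ℝ))).locallyPathConnectedSpace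

/-- Joining two points of a preconnected subset of an open set of the strip by a path. -/
theorem joinedIn_of_isPreconnected {U C : Set Strip} (hU : IsOpen U) (hC : IsPreconnected C)
    (hCU : C ⊆ U) {x y : Strip} (hx : x ∈ C) (hy : y ∈ C) : JoinedIn U x y := by
  have hconn : IsConnected (connectedComponentIn U x) :=
    isConnected_connectedComponentIn_iff.2 (hCU hx)
  have := hU.connectedComponentIn.isConnected_iff_isPathConnected.1 hconn
  exact (this.joinedIn x (mem_connectedComponentIn (hCU hx)) y
    (hC.subset_connectedComponentIn hx hCU hy)).mono (connectedComponentIn_subset _ _)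

/-- A path from the bottom to the top of the strip meets every path of the strip that starts on
its left and ends on its right. -/
theorem exists_path_eq_path {a b c d : Strip} (γ : Path a b) (β : Path c d)
    (ha : a.2 = 0) (hb : b.2 = 1) (hc : ∀ s, c.1 ≤ (γ s).1) (hd : ∀ s, (γ s).1 ≤ d.1) :
    ∃ s t, γ s = β t := by
  obtain ⟨⟨s, t⟩, hst⟩ := exists_eq_zero_of_sides
    (g := fun p => ⟨(γ.extend p.1).1 - (β.extend p.2).1,
      ((γ.extend p.1).2 : ℝ) - (β.extend p.2).2⟩)
    (by
      have h1 : Continuous fun p : ℝ × ℝ => γ.extend p.1 := γ.continuous_extend.comp continuous_fst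
      have h2 : Continuous fun p : ℝ × ℝ => β.extend p.2 := β.continuous_extend.comp continuous_snd
      have := Complex.equivRealProdCLM.symm.continuous.comp
        (((continuous_fst.comp h1).sub (continuous_fst.comp h2)).prodMk
        ((continuous_subtype_val.comp (continuous_snd.comp h1)).sub
          (continuous_subtype_val.comp (continuous_snd.comp h2))))
      convert this using 1
      funext p
      apply Complex.ext <;> simp)
    (fun t => by simpa [ha] using unitInterval.nonneg _)
    (fun t => by simpa [hb] using unitInterval.le_one _)
    (fun s => by
      simp only [Path.extend_zero, sub_nonneg]
      exact hc _)
    (fun s => by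
      simp only [Path.extend_one, sub_nonpos]
      exact hd _)
  have h1 := congrArg Complex.re hst
  have h2 := congrArg Complex.im hst
  simp only [Complex.zero_re, Complex.zero_im, sub_eq_zero] at h1 h2
  exact ⟨_, _, Prod.ext h1 (Subtype.ext h2)⟩

/-! ### Compactness in the strip and limits of unbounded connected sets -/

theorem isBounded_of_mem_Icc {s : Set Strip} {a b : ℝ} (h : ∀ z ∈ s, z.1 ∈ Set.Icc a b) :
    Bornology.IsBounded s := by
  refine ((Metric.isBounded_Icc a b).prod (isCompact_univ (X := unitInterval)).isBounded).subset ?_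
  exact fun z hz => ⟨h z hz, Set.mem_univ _⟩

theorem isCompact_inter_Icc {s : Set Strip} (hs : IsClosed s) (a b : ℝ) :
    IsCompact (s ∩ {z | z.1 ∈ Set.Icc a b}) :=
  Metric.isCompact_of_isClosed_isBounded
    (hs.inter (isClosed_Icc.preimage continuous_fst)) (isBounded_of_mem_Icc fun _ hz => hz.2)

/-- An unbounded subset of the left half strip extends arbitrarily far to the left. -/
theorem exists_fst_lt {s : Set Strip} (hs : s ⊆ leftHalf) (hb : ¬ Bornology.IsBounded s) (M : ℝ) :
    ∃ q ∈ s, q.1 < M := by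
  by_contra! h
  exact hb (isBounded_of_mem_Icc (a := M) (b := 0) fun z hz => ⟨h z hz, hs hz⟩)

/-- A compact set splits off a neighbourhood of a connected component that avoids a closed set. -/
theorem exists_isCompact_partition {X : Type*} [TopologicalSpace X] [T2Space X] {K P : Set X}
    (hK : IsCompact K) (hP : IsClosed P) {w : X} (hw : w ∈ K)
    (hd : Disjoint (connectedComponentIn K w) P) :
    ∃ Q₁ Q₂ : Set X, IsCompact Q₁ ∧ IsCompact Q₂ ∧ Disjoint Q₁ Q₂ ∧ Q₁ ∪ Q₂ = K ∧ w ∈ Q₁ ∧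
      Disjoint Q₁ P := by
  have : CompactSpace K := isCompact_iff_compactSpace.1 hK
  let w' : K := ⟨w, hw⟩
  have hcomp : (⋂ s : { s : Set K // IsClopen s ∧ w' ∈ s }, (s : Set K)) ⊆
      (Subtype.val ⁻¹' P)ᶜ := by
    rw [← connectedComponent_eq_iInter_isClopen]
    intro x hx hxP
    refine Set.disjoint_left.1 hd ?_ hxP
    rw [connectedComponentIn_eq_image hw]
    exact ⟨x, hx, rfl⟩
  have : Nonempty { s : Set K // IsClopen s ∧ w' ∈ s } :=
    ⟨⟨Set.univ, isClopen_univ, Set.mem_univ _⟩⟩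
  obtain ⟨⟨Q, hQ, hwQ⟩, hQP⟩ := exists_subset_nhds_of_compactSpace
    (V := fun s : { s : Set K // IsClopen s ∧ w' ∈ s } => (s : Set K))
    (fun s t => ⟨⟨s ∩ t, s.2.1.inter t.2.1, s.2.2, t.2.2⟩, Set.inter_subset_left,
      Set.inter_subset_right⟩) (fun s => s.2.1.isClosed)
    (U := (Subtype.val ⁻¹' P)ᶜ)
    (fun x hx => (hP.preimage continuous_subtype_val).isOpen_compl.mem_nhds (hcomp hx))
  refine ⟨Subtype.val '' Q, Subtype.val '' Qᶜ, hQ.isClosed.isCompact.image continuous_subtype_val,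
    hQ.compl.isClosed.isCompact.image continuous_subtype_val,
    (Set.disjoint_image_iff Subtype.val_injective).2 disjoint_compl_right, ?_, ⟨w', hwQ, rfl⟩, ?_⟩
  · rw [← Set.image_union, Set.union_compl_self, Set.image_univ, Subtype.range_coe]
  · rw [Set.disjoint_left]
    rintro _ ⟨x, hx, rfl⟩ hxP
    exact hQP hx hxP

/-- Limits of unbounded connected subsets of a decreasing sequence of closed sets. -/
theorem not_isBounded_connectedComponentIn_of_mapClusterPt {A Γ : ℕ → Set Strip} {u : ℕ → Strip}
    {w : Strip} (hA : Antitone A) (hcl : ∀ n, IsClosed (A n)) (hleft : ∀ n, A n ⊆ leftHalf)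
    (hΓ : ∀ n, IsPreconnected (Γ n)) (hΓA : ∀ n, Γ n ⊆ A n)
    (hΓb : ∀ n, ¬ Bornology.IsBounded (Γ n)) (hu : ∀ n, u n ∈ Γ n)
    (hw : MapClusterPt w atTop u) :
    w ∈ (⋂ n, A n) ∧ ¬ Bornology.IsBounded (connectedComponentIn (⋂ n, A n) w) := by
  have hwA : w ∈ ⋂ n, A n := Set.mem_iInter.2 fun n => (hcl n).mem_of_mapClusterPt hw
    (eventually_atTop.2 ⟨n, fun k hk => hA hk (hΓA k (hu k))⟩)
  refine ⟨hwA, fun hb => ?_⟩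
  obtain ⟨m, hm⟩ := hb.image_fst.bddBelow
  replace hm : ∀ z ∈ connectedComponentIn (⋂ n, A n) w, m ≤ z.1 := fun z hz => hm ⟨z, hz, rfl⟩
  have hKeq : ∀ n, IsCompact (A n ∩ {z | z.1 ∈ Set.Icc (m - 1) 0}) :=
    fun n => isCompact_inter_Icc (hcl n) _ _
  have hK : IsCompact ((⋂ n, A n) ∩ {z | z.1 ∈ Set.Icc (m - 1) 0}) :=
    isCompact_inter_Icc (isClosed_iInter hcl) _ _
  have hwm := hm w (mem_connectedComponentIn hwA)
  -- The component of `w` stays in `x ≥ m`, so within the window `[m - 1, 0]` a clopen piece `Q₁`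
  -- around `w` avoids the edge `x = m - 1`.
  obtain ⟨Q₁, Q₂, hQ₁, hQ₂, hQd, hQK, hwQ, hQP⟩ := exists_isCompact_partition hK
    (P := {z : Strip | z.1 ≤ m - 1}) (isClosed_le continuous_fst continuous_const)
    (w := w) ⟨hwA, by linarith, hleft 0 (Set.mem_iInter.1 hwA 0)⟩
    (Set.disjoint_left.2 fun z hz hzP => by
      have := hm z (connectedComponentIn_mono _ Set.inter_subset_left hz)
      simp only [Set.mem_ofPred_eq] at hzP
      linarith)
  obtain ⟨U₁, U₂, hU₁, hU₂, hQU₁, hQU₂, hUd⟩ := SeparatedNhds.of_isCompact_isCompact hQ₁ hQ₂ hQd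
  set V₁ := U₁ ∩ {z : Strip | m - 1 < z.1} with hV₁def
  set V₂ := U₂ ∪ {z : Strip | z.1 < m - 1} with hV₂def
  have hV₁ : IsOpen V₁ := hU₁.inter (isOpen_lt continuous_const continuous_fst)
  have hV₂ : IsOpen V₂ := hU₂.union (isOpen_lt continuous_fst continuous_const)
  have hVd : Disjoint V₁ V₂ := by
    rw [Set.disjoint_left]
    rintro z ⟨hz1, hz2⟩ (hz | hz)
    · exact Set.disjoint_left.1 hUd hz1 hz
    · exact lt_asymm (show m - 1 < z.1 from hz2) hz
  have hQV₁ : Q₁ ⊆ V₁ := fun z hz => 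
    ⟨hQU₁ hz, show m - 1 < z.1 from not_le.1 fun h => Set.disjoint_left.1 hQP hz h⟩
  -- By compactness `V₁` and `V₂` already separate the late `A n`. A late `Γ k` meeting `V₁` is then
  -- trapped in `V₁`, which makes it bounded.
  obtain ⟨n, hn⟩ := exists_subset_nhds_of_isCompact
    (V := fun n => A n ∩ {z : Strip | z.1 ∈ Set.Icc (m - 1) 0})
    (directed_of_isDirected_le fun i j hij => Set.inter_subset_inter_left _ (hA hij)) hKeq
    (U := V₁ ∪ V₂) (fun x hx => (hV₁.union hV₂).mem_nhds (by
      rw [← Set.iInter_inter, ← hQK] at hx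
      exact hx.imp (fun h => hQV₁ h) fun h => Or.inl (hQU₂ h)))
  obtain ⟨k, hk, hkV⟩ := (mapClusterPt_iff_frequently.1 hw V₁
    (hV₁.mem_nhds (hQV₁ hwQ))).forall_exists_of_atTop n
  have hsub : Γ k ⊆ V₁ := by
    refine IsPreconnected.subset_left_of_subset_union hV₁ hV₂ hVd (fun z hz => ?_)
      ⟨u k, hu k, hkV⟩ (hΓ k)
    have hzA := hΓA k hz
    rcases lt_or_ge z.1 (m - 1) with h | h
    · exact Or.inr (Or.inr h)
    · exact hn ⟨hA hk hzA, h, hleft k hzA⟩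
  exact hΓb k (isBounded_of_mem_Icc (a := m - 1) (b := 0) fun z hz =>
    ⟨(hsub hz).2.le, hleft k (hΓA k hz)⟩)

/-! ### Recurrence under a transitive homeomorphism -/

/-- Two integers with the same remainder among infinitely many. -/
theorem exists_lt_modEq {S : Set ℤ} (hS : S.Infinite) {N : ℕ} (hN : 0 < N) :
    ∃ a ∈ S, ∃ n : ℕ, 0 < n ∧ a + N * n ∈ S := by
  have hN' : (N : ℤ) ≠ 0 := by positivity
  obtain ⟨x, hx, y, hy, hxy, hmod⟩ := hS.exists_ne_map_eq_of_mapsTo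
    (f := fun a : ℤ => a % N) (t := Set.Ico 0 (N : ℤ))
    (fun a _ => ⟨Int.emod_nonneg _ hN', Int.emod_lt_of_pos _ (by positivity)⟩) (Set.finite_Ico _ _)
  have key : ∀ x ∈ S, ∀ y ∈ S, x < y → x % N = y % N → ∃ a ∈ S, ∃ n : ℕ, 0 < n ∧ a + N * n ∈ S := by
    intro x hx y hy hlt h
    obtain ⟨c, hc⟩ := (Int.ModEq.dvd (n := (N : ℤ)) h : (N : ℤ) ∣ y - x)
    have hc0 : 0 < c := by
      have : 0 < (N : ℤ) * c := by omega
      exact pos_of_mul_pos_right this (by positivity)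
    refine ⟨x, hx, c.toNat, by omega, ?_⟩
    rw [Int.toNat_of_nonneg hc0.le, ← hc]
    simpa using hy
  rcases hxy.lt_or_gt with h | h
  · exact key x hx y hy h hmod
  · exact key y hy x hx h hmod.symm

/-- The iterates of a transitive homeomorphism have no wandering open sets. -/
theorem IsTransitive.exists_iterate_mem {F : Strip ≃ₜ Strip} (hF : IsTransitive F) {O : Set Strip}
    (hO : IsOpen O) (hne : O.Nonempty) {N : ℕ} (hN : 0 < N) :
    ∃ z ∈ O, ∃ n : ℕ, 0 < n ∧ ((F ^ N) ^ n) z ∈ O := by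
  obtain ⟨z, hz⟩ := hF
  have hinf : {k : ℤ | (F ^ k) z ∈ O}.Infinite := by
    intro hfin
    -- The strip has no isolated points, so a dense orbit with finitely many points removed is still
    -- dense and must visit `O` again.
    have hd := hz.sdiff_finite (hfin.image fun k : ℤ => (F ^ k) z)
    obtain ⟨w, hwO, ⟨k, rfl⟩, hk⟩ := hd.inter_open_nonempty O hO hne
    exact hk ⟨k, hwO, rfl⟩
  obtain ⟨a, ha, n, hn, han⟩ := exists_lt_modEq hinf hN
  refine ⟨(F ^ a) z, ha, n, hn, ?_⟩
  rw [← Homeomorph.mul_apply, ← pow_mul, ← zpow_natCast, ← zpow_add, add_comm]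
  simpa using han

/-! ### Crossing of paths with connected sets that reach the left end -/

/-- Phrasing the crossing through `JoinedIn` lets concatenated paths be handled as unions of sets,
without parametrizations. -/
theorem inter_nonempty_of_joinedIn {S S' : Set Strip} {a b c d : Strip} (h : JoinedIn S a b)
    (h' : JoinedIn S' c d) (ha : a.2 = 0) (hb : b.2 = 1) (hc : ∀ z ∈ S, c.1 ≤ z.1)
    (hd : ∀ z ∈ S, z.1 ≤ d.1) : (S ∩ S').Nonempty := by
  obtain ⟨s, t, hst⟩ := exists_path_eq_path h.somePath h'.somePath ha hb
    (fun s => hc _ (h.somePath_mem s)) (fun s => hd _ (h.somePath_mem s))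
  exact ⟨_, h.somePath_mem s, hst ▸ h'.somePath_mem t⟩

theorem Path.exists_bounds {a b : Strip} (γ : Path a b) :
    ∃ m M : ℝ, ∀ z ∈ Set.range γ, m ≤ z.1 ∧ z.1 ≤ M := by
  have hc : IsCompact (Prod.fst '' Set.range γ) :=
    (isCompact_range γ.continuous).image continuous_fst
  obtain ⟨m, hm⟩ := hc.bddBelow
  obtain ⟨M, hM⟩ := hc.bddAbove
  exact ⟨m, M, fun z hz => ⟨hm ⟨z, hz, rfl⟩, hM ⟨z, hz, rfl⟩⟩⟩

theorem Path.joinedIn_range {a b : Strip} (γ : Path a b) : JoinedIn (Set.range γ) a b :=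
  ⟨γ, fun t => ⟨t, rfl⟩⟩

/-- A path from the bottom to the top of the strip meets every connected set that reaches
from its right to the left end. -/
theorem exists_path_mem_of_isPreconnected {Γ : Set Strip} (hΓ : IsPreconnected Γ)
    (hleft : ∀ M : ℝ, ∃ q ∈ Γ, q.1 < M) {x : Strip} (hx : x ∈ Γ) {a b : Strip} (γ : Path a b)
    (ha : a.2 = 0) (hb : b.2 = 1) (hγ : ∀ s, (γ s).1 ≤ x.1) : ∃ s, γ s ∈ Γ := by
  by_contra! hne
  obtain ⟨m, _, hm⟩ := Path.exists_bounds γ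
  obtain ⟨q, hq, hqm⟩ := hleft m
  have hU : IsOpen (Set.range γ)ᶜ := (isCompact_range γ.continuous).isClosed.isOpen_compl
  have hj := joinedIn_of_isPreconnected hU hΓ
    (fun z hz => by rintro ⟨s, rfl⟩; exact hne s hz) hq hx
  obtain ⟨z, hz, hz'⟩ := inter_nonempty_of_joinedIn (Path.joinedIn_range γ) hj ha hb
    (fun z hz => hqm.le.trans (hm z hz).1) (by rintro _ ⟨s, rfl⟩; exact hγ s)
  exact hz' hz

theorem joinedIn_horizontal {x y : ℝ} (h : x ≤ y) (i : unitInterval) :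
    JoinedIn ((fun t : ℝ => ((t, i) : Strip)) '' Set.Icc x y) (x, i) (y, i) :=
  (((convex_Icc x y).isPathConnected ⟨x, le_rfl, h⟩).image (by fun_prop)).joinedIn _
    ⟨x, ⟨le_rfl, h⟩, rfl⟩ _ ⟨y, ⟨h, le_rfl⟩, rfl⟩

instance : PathConnectedSpace unitInterval :=
  isPathConnected_iff_pathConnectedSpace.1 ((convex_Icc (0 : ℝ) 1).isPathConnected ⟨0, by simp⟩)

theorem joinedIn_vertical (q : Strip) :
    JoinedIn (Set.range fun t : unitInterval => ((q.1, q.2 ⊔ t) : Strip)) q (q.1, 1) :=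
  (isPathConnected_range (by fun_prop)).joinedIn _ ⟨0, by simp⟩ _ ⟨1, by simp [unitInterval.le_one']⟩

/-- A connected set that starts at `(a, 0)`, meets the bottom line nowhere else, and reaches the
left end separates the two halves of the bottom line. -/
theorem exists_path_mem_of_bottom {C : Set Strip} (hC : IsPreconnected C)
    (hleft : ∀ M : ℝ, ∃ q ∈ C, q.1 < M) {a l r : ℝ} (ha : ((a, 0) : Strip) ∈ C)
    (hbot : ∀ z ∈ C, z.2 = 0 → z.1 = a) (hl : l < a) (hr : a < r)
    (β : Path ((l, 0) : Strip) (r, 0)) : ∃ s, β s ∈ C := by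
  by_contra! hne
  obtain ⟨m, M, hm⟩ := Path.exists_bounds β
  obtain ⟨q, hq, hqm⟩ := hleft m
  -- `β` is prolonged by the two outer bottom rays, so that it can be made to start and end beyond
  -- any bounded path. `C` still avoids the result.
  set Z : Set Strip := Set.range β ∪ {z | z.2 = 0 ∧ (z.1 ≤ l ∨ r ≤ z.1)} with hZ
  have hZc : IsClosed Z := by
    refine (isCompact_range β.continuous).isClosed.union ?_
    exact (isClosed_eq continuous_snd continuous_const).inter
      ((isClosed_le continuous_fst continuous_const).union
        (isClosed_le continuous_const continuous_fst))
  have hCZ : C ⊆ Zᶜ := by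
    rintro z hz (⟨s, rfl⟩ | ⟨h0, h⟩)
    · exact hne s hz
    · have := hbot z hz h0
      rcases h with h | h <;> linarith
  have hj := joinedIn_of_isPreconnected hZc.isOpen_compl hC hCZ ha hq
  obtain ⟨m', M', hm'⟩ := Path.exists_bounds hj.somePath
  have hlm : m ≤ l := (hm (l, 0) ⟨0, by simp⟩).1
  have hq0 : q.2 ≠ 0 := fun h => by
    have := hbot q hq h
    linarith
  -- A path from `(a, 0)` to `q` off `Z`, followed by the vertical segment above `q`, runs from
  -- bottom to top. The vertical part also misses `Z`, since `q` is left of `β` and not on the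
  -- bottom line.
  have hγ := ((Path.joinedIn_range hj.somePath).mono Set.subset_union_left).trans
    ((joinedIn_vertical q).mono (Set.subset_union_right (s := Set.range hj.somePath)))
  have hqγ : q ∈ Set.range hj.somePath := ⟨1, by simp⟩
  obtain ⟨z, hz, hz'⟩ := inter_nonempty_of_joinedIn hγ
    ((joinedIn_horizontal (min_le_right m' l) 0).mono
      (Set.subset_union_left.trans Set.subset_union_left) |>.trans
    ((Path.joinedIn_range β).mono
      (Set.subset_union_right.trans Set.subset_union_left)) |>.trans
    ((joinedIn_horizontal (le_max_right M' r) 0).mono Set.subset_union_right)) rfl rfl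
    (by
      rintro z (hz | ⟨t, rfl⟩)
      · exact (min_le_left _ _).trans (hm' z hz).1
      · exact (min_le_left _ _).trans (hm' q hqγ).1)
    (by
      rintro z (hz | ⟨t, rfl⟩)
      · exact (hm' z hz).2.trans (le_max_left _ _)
      · exact (hm' q hqγ).2.trans (le_max_left _ _))
  have hzZ : z ∈ Z := by
    rcases hz' with (⟨x, hx, rfl⟩ | h) | ⟨x, hx, rfl⟩
    · exact Or.inr ⟨rfl, Or.inl hx.2⟩
    · exact Or.inl h
    · exact Or.inr ⟨rfl, Or.inr hx.1⟩
  rcases hz with ⟨s, rfl⟩ | ⟨t, rfl⟩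
  · exact hj.somePath_mem s hzZ
  · rcases hzZ with h | ⟨h, -⟩
    · exact absurd (hm _ h).1 (not_le.2 hqm)
    · simp only [← bot_eq_zero, sup_eq_bot_iff] at h
      exact hq0 h.1

/-! ### Hair sets and transitivity -/

/-- A nonempty closed invariant subset of the strip, disjoint from the boundary, all of whose
points lie on connected subsets reaching the left end. -/
structure IsHairSet (F : Strip ≃ₜ Strip) (D : Set Strip) : Prop where
  isClosed : IsClosed D
  nonempty : D.Nonempty
  image_eq : F '' D = D
  exists_hair : ∀ z ∈ D, ∃ Γ ⊆ D, IsPreconnected Γ ∧ z ∈ Γ ∧ ∀ M : ℝ, ∃ q ∈ Γ, q.1 < M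
  ne_zero : ∀ z ∈ D, z.2 ≠ 0
  ne_one : ∀ z ∈ D, z.2 ≠ 1

theorem image_zpow_eq {F : Strip ≃ₜ Strip} {U : Set Strip} (h : F '' U = U) (n : ℤ) :
    ⇑(F ^ n) '' U = U := by
  have h' : ⇑(F⁻¹) '' U = U := by
    conv_lhs => rw [← h]
    exact F.symm_image_image U
  have hmul : ∀ A B : Strip ≃ₜ Strip, ⇑(A * B) '' U = A '' (B '' U) :=
    fun A B => Set.image_comp A B U
  induction n using Int.induction_on with
  | zero => exact Set.image_id U
  | succ n ih => rw [zpow_add_one, hmul, h, ih]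
  | pred n ih => rw [zpow_sub_one, hmul, h', ih]

/-- The dense orbit enters every nonempty open set; if that set is invariant, it contains the base
point of the orbit. -/
theorem IsTransitive.inter_nonempty {F : Strip ≃ₜ Strip} (hF : IsTransitive F) {U V : Set Strip}
    (hU : IsOpen U) (hV : IsOpen V) (hUn : U.Nonempty) (hVn : V.Nonempty) (hFU : F '' U = U)
    (hFV : F '' V = V) : (U ∩ V).Nonempty := by
  obtain ⟨z, hz⟩ := hF
  have key : ∀ W : Set Strip, IsOpen W → W.Nonempty → F '' W = W → z ∈ W := by
    intro W hW hWn hFW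
    obtain ⟨w, hw, n, rfl⟩ := hz.inter_open_nonempty W hW hWn
    rw [← image_zpow_eq hFW n] at hw
    exact (F ^ n).injective.mem_set_image.1 hw
  exact ⟨z, key U hU hUn hFU, key V hV hVn hFV⟩

/-- The horizontal translation of the strip. -/
def shift (c : ℝ) : Strip ≃ₜ Strip := (Homeomorph.addRight c).prodCongr (Homeomorph.refl _)

@[simp] theorem shift_fst (c : ℝ) (z : Strip) : (shift c z).1 = z.1 + c := rfl

@[simp] theorem shift_snd (c : ℝ) (z : Strip) : (shift c z).2 = z.2 := rfl

theorem map_shift_intCast {F : Strip ≃ₜ Strip} (hT : ∀ z, F (translate z) = translate (F z))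
    (k : ℤ) (z : Strip) : F (shift k z) = shift k (F z) := by
  have hs : ∀ (k : ℝ) (z : Strip), shift (k + 1) z = translate (shift k z) := fun k z =>
    Prod.ext (by simp [translate, add_assoc]) rfl
  have h0 : ∀ z : Strip, shift 0 z = z := fun z => Prod.ext (by simp) rfl
  induction k using Int.induction_on with
  | zero => simp [h0]
  | succ n ih => rw [Int.cast_add, Int.cast_one, hs, hT, ih, hs]
  | pred n ih =>
    have h1 := hs ((-n - 1 : ℤ) : ℝ) z
    have h2 := hs ((-n - 1 : ℤ) : ℝ) (F z)
    have h3 : (((-n - 1 : ℤ) : ℝ) + 1) = ((-n : ℤ) : ℝ) := by push_cast; ring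
    rw [h3] at h1 h2
    rw [h1, hT, h2] at ih
    exact Prod.ext (add_right_cancel (congrArg Prod.fst ih)) (Prod.ext_iff.1 ih).2

theorem isPreconnected_horizontal_line (i : unitInterval) :
    IsPreconnected {z : Strip | z.2 = i} := by
  have : {z : Strip | z.2 = i} = Set.range fun t : ℝ => ((t, i) : Strip) := by
    ext z
    exact ⟨fun h => ⟨z.1, Prod.ext rfl h.symm⟩, by rintro ⟨t, rfl⟩; rfl⟩
  rw [this]
  exact isPreconnected_range (by fun_prop)

/-- `F` permutes the components of `W`, and the one containing the invariant connected line `y = i`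
must be fixed. -/
theorem image_connectedComponentIn_line {F : Strip ≃ₜ Strip} {W : Set Strip} (hW : F '' W = W)
    {i : unitInterval} (hi : ∀ z, (F z).2 = i ↔ z.2 = i) (hiW : {z : Strip | z.2 = i} ⊆ W) :
    F '' connectedComponentIn W (0, i) = connectedComponentIn W (0, i) := by
  rw [F.image_connectedComponentIn (hiW rfl), hW]
  exact (connectedComponentIn_eq ((isPreconnected_horizontal_line i).subset_connectedComponentIn
    (x := ((0, i) : Strip)) rfl hiW ((hi _).2 rfl))).symm

/-- Under a transitive lift, a hair set comes arbitrarily close to the boundary. -/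
theorem IsHairSet.exists_near_boundary {F : Strip ≃ₜ Strip} {D : Set Strip} (hD : IsHairSet F D)
    (htrans : IsTransitive F) (hT : ∀ z, F (translate z) = translate (F z))
    (hbot : ∀ z, (F z).2 = 0 ↔ z.2 = 0) (htop : ∀ z, (F z).2 = 1 ↔ z.2 = 1)
    {ε : ℝ} (hε : 0 < ε) : ∃ z ∈ D, (z.2 : ℝ) < ε ∨ 1 - ε < z.2 := by
  by_contra! hfar
  set S : Set Strip := ⋃ k : ℤ, shift k '' D with hS
  have hFS : F '' S = S := by
    rw [hS, Set.image_iUnion]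
    refine Set.iUnion_congr fun k => ?_
    rw [← Set.image_comp, show ⇑F ∘ shift k = shift k ∘ F from funext (map_shift_intCast hT k),
      Set.image_comp, hD.image_eq]
  have hE : ∀ z ∈ closure S, ε ≤ z.2 ∧ (z.2 : ℝ) ≤ 1 - ε := by
    intro z hz
    have hc : Continuous fun z : Strip => (z.2 : ℝ) := by fun_prop
    have hcl : IsClosed {z : Strip | ε ≤ z.2 ∧ (z.2 : ℝ) ≤ 1 - ε} :=
      (isClosed_le continuous_const hc).inter (isClosed_le hc continuous_const)
    refine closure_minimal ?_ hcl hz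
    rw [hS, Set.iUnion_subset_iff]
    rintro k _ ⟨w, hw, rfl⟩
    exact hfar w hw
  have hFW : F '' (closure S)ᶜ = (closure S)ᶜ := by
    rw [Set.image_compl_eq F.bijective, F.image_closure, hFS]
  have hW : IsOpen (closure S)ᶜ := isClosed_closure.isOpen_compl
  have h0W : {z : Strip | z.2 = 0} ⊆ (closure S)ᶜ := fun z (hz : z.2 = 0) hzE => by
    have := (hE z hzE).1
    rw [hz] at this
    simp only [Set.Icc.coe_zero] at this
    linarith
  have h1W : {z : Strip | z.2 = 1} ⊆ (closure S)ᶜ := fun z (hz : z.2 = 1) hzE => by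
    have := (hE z hzE).2
    rw [hz] at this
    simp only [Set.Icc.coe_one] at this
    linarith
  obtain ⟨w, hw0, hw1⟩ := htrans.inter_nonempty hW.connectedComponentIn hW.connectedComponentIn
    ⟨_, mem_connectedComponentIn (h0W (show ((0, 0) : Strip) ∈ {z : Strip | z.2 = 0} from rfl))⟩
    ⟨_, mem_connectedComponentIn (h1W (show ((0, 1) : Strip) ∈ {z : Strip | z.2 = 1} from rfl))⟩
    (image_connectedComponentIn_line hFW hbot h0W) (image_connectedComponentIn_line hFW htop h1W)
  have hmem : ((0, 1) : Strip) ∈ connectedComponentIn (closure S)ᶜ (0, 0) := by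
    rw [connectedComponentIn_eq hw0, ← connectedComponentIn_eq hw1]
    exact mem_connectedComponentIn (h1W rfl)
  obtain ⟨γ, hγ⟩ := joinedIn_of_isPreconnected hW isPreconnected_connectedComponentIn
    (connectedComponentIn_subset _ _) (mem_connectedComponentIn (h0W rfl)) hmem
  obtain ⟨x, hx⟩ := hD.nonempty
  obtain ⟨Γ, hΓD, hΓ, hxΓ, hleft⟩ := hD.exists_hair x hx
  obtain ⟨_, M, hM⟩ := Path.exists_bounds γ
  -- Shifted by `k`, the path `γ` lies to the left of `x`, so the hair through `x` crosses it;
  -- shifting back by `-k` puts a point of `S` on `γ`.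
  obtain ⟨k, hk⟩ := exists_int_lt (x.1 - M)
  obtain ⟨s, hs⟩ := exists_path_mem_of_isPreconnected hΓ hleft hxΓ (γ.map (shift k).continuous)
    rfl rfl (fun s => by
      have := (hM _ ⟨s, rfl⟩).2
      simp only [Path.map_coe, Function.comp_apply, shift_fst]
      linarith)
  refine hγ s (subset_closure (Set.mem_iUnion.2 ⟨-k, _, hΓD hs, ?_⟩))
  exact Prod.ext (by simp) rfl

/-- Under a transitive lift some iterate of which moves the points near the bottom to the right,
a hair set stays away from the bottom. -/
theorem IsHairSet.lt_snd {F : Strip ≃ₜ Strip} {D : Set Strip} (hD : IsHairSet F D)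
    (htrans : IsTransitive F) (hbot : ∀ z, (F z).2 = 0 ↔ z.2 = 0) {N : ℕ} (hN : 0 < N) {δ : ℝ}
    (hδ : 0 ≤ δ) (hmove : ∀ z : Strip, (z.2 : ℝ) ≤ δ → z.1 + 1 < ((F ^ N) z).1) {z : Strip}
    (hz : z ∈ D) : δ < z.2 := by
  by_contra! hzδ
  set G : Strip ≃ₜ Strip := F ^ N with hG
  have hGD : G '' D = D := by simpa using image_zpow_eq hD.image_eq N
  have hGmem : ∀ w, G w ∈ D ↔ w ∈ D := fun w => by
    conv_lhs => rw [← hGD]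
    exact G.injective.mem_set_image
  have hGbot : ∀ w, (G w).2 = 0 ↔ w.2 = 0 := by
    rw [hG]
    clear_value G
    clear hG hmove hGD hGmem hN
    induction N with
    | zero => exact fun w => Iff.rfl
    | succ n ih =>
      intro w
      rw [pow_succ', Homeomorph.mul_apply, hbot, ih]
  have hGbot' : ∀ x : ℝ, ∃ b : ℝ, b < x - 1 ∧ G (b, 0) = (x, 0) := by
    intro x
    have h2 : (G.symm (x, 0)).2 = 0 := by rw [← hGbot, G.apply_symm_apply]
    have h3 : G.symm (x, 0) = ((G.symm (x, 0)).1, 0) := Prod.ext rfl h2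
    refine ⟨(G.symm (x, 0)).1, ?_, by rw [← h3, G.apply_symm_apply]⟩
    have := hmove (G.symm (x, 0)) (by rw [h2]; simpa using hδ)
    rw [G.apply_symm_apply] at this
    simp only at this
    linarith
  obtain ⟨a, y⟩ := z
  -- The lowest point `(a, h)` of `D` on the vertical line through `z`: the segment `α` below it
  -- meets `D` only at its upper end.
  obtain ⟨h, hhD, hhle⟩ := (hD.isClosed.preimage
    (show Continuous fun y : unitInterval => ((a, y) : Strip) by fun_prop)).isCompact.exists_isLeast
    ⟨y, hz⟩
  have hhδ : (h : ℝ) ≤ δ := le_trans (Subtype.coe_le_coe.2 (hhle hz)) hzδ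
  have hh0 : 0 < h := unitInterval.pos_iff_ne_zero.2 (hD.ne_zero (a, h) hhD)
  set α₀ : Set Strip := (fun y : unitInterval => ((a, y) : Strip)) '' Set.Iio h with hα₀
  set α : Set Strip := (fun y : unitInterval => ((a, y) : Strip)) '' Set.Iic h with hα
  have hα₀c : IsPreconnected α₀ := isPreconnected_Iio.image _ (by fun_prop)
  have hαc : IsPreconnected α := isPreconnected_Iic.image _ (by fun_prop)
  have hαcl : IsClosed α := (isClosed_Iic.isCompact.image (by fun_prop)).isClosed
  have hα₀α : α₀ ⊆ α := Set.image_mono Set.Iio_subset_Iic_self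
  have hαD : ∀ w ∈ α, w ∈ α₀ ∨ w ∈ D := by
    rintro _ ⟨t, ht, rfl⟩
    rcases (show t ≤ h from ht).lt_or_eq with h' | rfl
    · exact Or.inl ⟨t, h', rfl⟩
    · exact Or.inr hhD
  have hα₀D : ∀ w ∈ α₀, w ∉ D := by
    rintro _ ⟨t, ht, rfl⟩ hD'
    exact not_lt.2 (hhle hD') ht
  have hα1 : ∀ w ∈ α, w.1 = a := by rintro _ ⟨t, -, rfl⟩; rfl
  have hGα : ∀ w ∈ α, a + 1 < (G w).1 := by
    rintro _ ⟨t, ht, rfl⟩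
    exact hmove (a, t) (le_trans (Subtype.coe_le_coe.2 ht) hhδ)
  have ha0 : ((a, 0) : Strip) ∈ α₀ := ⟨0, hh0, rfl⟩
  set W : Set Strip := (D ∪ α)ᶜ with hW
  have hWo : IsOpen W := (hD.isClosed.union hαcl).isOpen_compl
  have hbW : ∀ x : ℝ, x ≠ a → ((x, 0) : Strip) ∈ W := by
    rintro x hx (h' | h')
    · exact hD.ne_zero _ h' rfl
    · exact hx (hα1 _ h')
  set Lc := connectedComponentIn W ((a - 1, 0) : Strip) with hLc
  set Rc := connectedComponentIn W ((a + 1, 0) : Strip) with hRc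
  have hL : ∀ x < a, ((x, 0) : Strip) ∈ Lc := fun x hx =>
    (isPreconnected_Iio.image (fun x : ℝ => ((x, 0) : Strip))
      (by fun_prop)).subset_connectedComponentIn ⟨a - 1, sub_one_lt a, rfl⟩
      (by rintro _ ⟨t, ht, rfl⟩; exact hbW t (ne_of_lt ht)) ⟨x, hx, rfl⟩
  have hR : ∀ x, a < x → ((x, 0) : Strip) ∈ Rc := fun x hx =>
    (isPreconnected_Ioi.image (fun x : ℝ => ((x, 0) : Strip))
      (by fun_prop)).subset_connectedComponentIn ⟨a + 1, lt_add_one a, rfl⟩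
      (by rintro _ ⟨t, ht, rfl⟩; exact hbW t (ne_of_gt ht)) ⟨x, hx, rfl⟩
  -- The hair through `(a, h)` together with `α` is connected, reaches the left end, and touches the
  -- bottom only at `a`, so it separates the two bottom rays.
  have hLR : ∀ w ∈ Lc, w ∉ Rc := by
    intro w hwL hwR
    have hmem : ((a + 1, 0) : Strip) ∈ Lc := by
      rw [hLc, connectedComponentIn_eq hwL, ← connectedComponentIn_eq hwR]
      exact hR _ (lt_add_one a)
    obtain ⟨β, hβ⟩ := joinedIn_of_isPreconnected hWo isPreconnected_connectedComponentIn
      (connectedComponentIn_subset _ _) (hL _ (sub_one_lt a)) hmem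
    obtain ⟨Γ, hΓD, hΓ, hxΓ, hleft⟩ := hD.exists_hair _ hhD
    obtain ⟨s, hs⟩ := exists_path_mem_of_bottom (C := Γ ∪ α) (a := a)
      (hΓ.union (a, h) hxΓ ⟨h, Set.mem_Iic.2 le_rfl, rfl⟩ hαc)
      (fun M => (hleft M).imp fun q hq => ⟨Or.inl hq.1, hq.2⟩) (Or.inr (hα₀α ha0))
      (by
        rintro w (hw | hw) h0
        · exact absurd h0 (hD.ne_zero w (hΓD hw))
        · exact hα1 w hw)
      (sub_one_lt a) (lt_add_one a) β
    exact hβ s (hs.imp (fun h => hΓD h) id)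
  -- `G` preserves `D` and moves `α` strictly to the right of itself, so the image of `α₀` avoids `D
  -- ∪ α`; it is attached to the right bottom ray.
  have hGα₀R : G '' α₀ ⊆ Rc := by
    have hsub : G '' α₀ ⊆ W := by
      rintro _ ⟨w, hw, rfl⟩ (h' | h')
      · exact hα₀D w hw ((hGmem w).1 h')
      · have h1 := hα1 _ h'
        have h2 := hGα w (hα₀α hw)
        linarith
    have hc := hGα _ (hα₀α ha0)
    have hmem : G (a, 0) ∈ Rc := by
      have : G (a, 0) = ((G (a, 0)).1, 0) := Prod.ext rfl ((hGbot _).2 rfl)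
      rw [this]
      exact hR _ (by linarith)
    rw [hRc, connectedComponentIn_eq hmem]
    exact (hα₀c.image _ G.continuous.continuousOn).subset_connectedComponentIn ⟨_, ha0, rfl⟩ hsub
  have hacc : ((a, 0) : Strip) ∈ closure Lc := by
    have h1 : a ∈ closure (Set.Iio a) := by simp
    have h2 := (show Continuous fun x : ℝ => ((x, 0) : Strip) by fun_prop).continuousAt
      (x := a) |>.continuousWithinAt.mem_closure_image h1
    exact closure_mono (by rintro _ ⟨x, hx, rfl⟩; exact hL x hx) h2
  -- The region `G '' Lc` is the left component cut out by `D ∪ G '' α`. The connected set `Lc ∪ α₀`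
  -- avoids that barrier and shares the left bottom ray, so `G` expands `Lc` across `α₀`.
  have hsubG : Lc ∪ α₀ ⊆ G '' Lc := by
    have hconn : IsPreconnected (Lc ∪ α₀) := by
      have h1 : IsPreconnected (insert ((a, 0) : Strip) Lc) :=
        isPreconnected_connectedComponentIn.subset_closure (Set.subset_insert _ _)
          (Set.insert_subset hacc subset_closure)
      have h2 := h1.union _ (Set.mem_insert _ _) ha0 hα₀c
      rwa [Set.insert_union, Set.insert_eq_of_mem (show _ ∈ Lc ∪ α₀ from Or.inr ha0)] at h2
    obtain ⟨b, hb, hGb⟩ := hGbot' (a - 1)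
    have hGW : G '' W = (D ∪ G '' α)ᶜ := by
      rw [hW, Set.image_compl_eq G.bijective, Set.image_union, hGD]
    have hsub : Lc ∪ α₀ ⊆ (D ∪ G '' α)ᶜ := by
      rintro w hw (hwD | ⟨v, hv, rfl⟩)
      · rcases hw with hw | hw
        · exact connectedComponentIn_subset _ _ hw (Or.inl hwD)
        · exact hα₀D w hw hwD
      · rcases hw with hw | hw
        · rcases hαD v hv with h' | h'
          · exact hLR _ hw (hGα₀R ⟨v, h', rfl⟩)
          · exact connectedComponentIn_subset _ _ hw (Or.inl ((hGmem v).2 h'))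
        · have h1 := hα1 _ (hα₀α hw)
          have h2 := hGα v hv
          linarith
    have himg : G '' Lc = connectedComponentIn (D ∪ G '' α)ᶜ (a - 1, 0) := by
      rw [hLc, connectedComponentIn_eq (hL b (by linarith)),
        G.image_connectedComponentIn (hbW b (by linarith)), hGb, hGW]
    rw [himg]
    exact hconn.subset_connectedComponentIn (Or.inl (hL _ (sub_one_lt a))) hsub
  have hGo : IsOpen (G '' Lc) := G.isOpenMap _ hWo.connectedComponentIn
  have hne : (Rc ∩ G '' Lc).Nonempty := by
    have h1 : a ∈ closure (Set.Ioi a) := by simp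
    have h2 := (show Continuous fun x : ℝ => ((x, 0) : Strip) by fun_prop).continuousAt
      (x := a) |>.continuousWithinAt.mem_closure_image h1
    obtain ⟨_, hw, x, hx, rfl⟩ := mem_closure_iff.1 h2 _ hGo (hsubG (Or.inr ha0))
    exact ⟨_, hR x hx, hw⟩
  -- `Rc ∩ G '' Lc` is wandering: a return to `G '' Lc` after `n ≥ 1` steps puts `G^(n-1) w` in
  -- `Lc`. As `Lc` is backward invariant, `w` itself would lie in `Lc` as well as in `Rc`.
  obtain ⟨w, hw, n, hn, hnw⟩ :=
    htrans.exists_iterate_mem (hWo.connectedComponentIn.inter hGo) hne hN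
  have hback : ∀ n v, (G ^ n) v ∈ Lc → v ∈ Lc := by
    intro n
    induction n with
    | zero => exact fun v hv => hv
    | succ n ih =>
      intro v hv
      rw [pow_succ', Homeomorph.mul_apply] at hv
      exact ih v (G.injective.mem_set_image.1 (hsubG (Or.inl hv)))
  obtain ⟨m, rfl⟩ := Nat.exists_eq_add_of_lt hn
  rw [zero_add, pow_succ', Homeomorph.mul_apply] at hnw
  exact hLR w (hback m w (G.injective.mem_set_image.1 hnw.2)) hw.1

/-! ### Rightward motion near the boundary lines -/

theorem coe_pow_eq_iterate (F : Strip ≃ₜ Strip) (n : ℕ) : ⇑(F ^ n) = F^[n] := by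
  induction n with
  | zero => rfl
  | succ n ih =>
    rw [pow_succ', Function.iterate_succ', ← ih]
    rfl

theorem iterate_translate {F : Strip ≃ₜ Strip} (hT : ∀ z, F (translate z) = translate (F z))
    (n : ℕ) (z : Strip) : F^[n] (translate z) = translate (F^[n] z) :=
  Function.Commute.iterate_left (f := F) (g := translate) hT n z

theorem HasBoundaryRotationNumber.tendsto_atTop {F : Strip ≃ₜ Strip} {i : unitInterval} {ρ : ℝ}
    (h : HasBoundaryRotationNumber F i ρ) (hρ : 0 < ρ) (x : ℝ) :
    Tendsto (fun n : ℕ => (F^[n] (x, i)).1) atTop atTop := by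
  have h1 := (h x).pos_mul_atTop hρ tendsto_natCast_atTop_atTop
  refine (tendsto_atTop_add_const_right _ x h1).congr' ?_
  filter_upwards [eventually_gt_atTop 0] with n hn
  have : (n : ℝ) ≠ 0 := by positivity
  field_simp
  ring

/-- If a boundary line has positive rotation number, some iterate moves all points near that line
to the right. -/
theorem HasBoundaryRotationNumber.exists_move_right {F : Strip ≃ₜ Strip} {i : unitInterval} {ρ : ℝ}
    (h : HasBoundaryRotationNumber F i ρ) (hρ : 0 < ρ)
    (hT : ∀ z, F (translate z) = translate (F z)) (hi : ∀ z, (F z).2 = i ↔ z.2 = i) :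
    ∃ N : ℕ, 0 < N ∧ ∃ δ : ℝ, 0 < δ ∧
      ∀ z : Strip, |(z.2 : ℝ) - i| ≤ δ → z.1 + 1 < ((F ^ N) z).1 := by
  set φ : ℝ → ℝ := fun x => (F (x, i)).1 with hφ
  have hFφ : ∀ x, F (x, i) = (φ x, i) := fun x => Prod.ext rfl ((hi _).2 rfl)
  have hφc : Continuous φ := by fun_prop
  have hφi : Function.Injective φ := fun x y hxy => by
    have : F (x, i) = F (y, i) := by rw [hFφ, hFφ, hxy]
    exact congrArg Prod.fst (F.injective this)
  have hφ1 : φ (0 + 1) = φ 0 + 1 := congrArg Prod.fst (hT (0, i))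
  have hmono : StrictMono φ := by
    rcases hφc.strictMono_of_inj hφi with hm | hm
    · exact hm
    · have := hm (lt_add_one (0 : ℝ))
      linarith
  have hiter : ∀ (n : ℕ) x, F^[n] (x, i) = (φ^[n] x, i) := by
    intro n
    induction n with
    | zero => exact fun x => rfl
    | succ n ih => intro x; rw [Function.iterate_succ_apply, hFφ, ih, Function.iterate_succ_apply]
  -- By monotonicity a value above `3` at `x = 0` stays above `3` on `[0, 1]`, where `x + 1 ≤ 2`.
  -- The tube lemma and integer translations then give a uniform neighbourhood of the whole line.
  obtain ⟨N, hN3, hN⟩ := (((h.tendsto_atTop hρ 0).eventually_gt_atTop 3).and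
    (eventually_gt_atTop 0)).exists
  have hN3' : ∀ x, 0 ≤ x → 3 < φ^[N] x := fun x hx => by
    rw [hiter] at hN3
    exact hN3.trans_le ((hmono.iterate N).monotone hx)
  have hcont : Continuous (F^[N]) := F.continuous.iterate N
  have hV : IsOpen {z : Strip | z.1 + 1 < (F^[N] z).1} :=
    isOpen_lt (by fun_prop) (continuous_fst.comp hcont)
  obtain ⟨u, v, -, hv, hu01, hiv, huv⟩ := generalized_tube_lemma (isCompact_Icc (a := (0 : ℝ)) (b := 1))
    (isCompact_singleton (x := i)) hV (by
      rintro ⟨x, y⟩ ⟨hx, rfl : y = i⟩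
      show x + 1 < (F^[N] (x, y)).1
      rw [hiter]
      linarith [hN3' x hx.1, hx.2])
  obtain ⟨δ, hδ, hball⟩ := Metric.isOpen_iff.1 hv i (hiv rfl)
  refine ⟨N, hN, δ / 2, by positivity, fun z hz => ?_⟩
  have hTN : ∀ z, (F ^ N) (translate z) = translate ((F ^ N) z) := by
    rw [coe_pow_eq_iterate]
    exact iterate_translate hT N
  have h1 := map_shift_intCast hTN (-⌊z.1⌋) z
  have h2 : (shift ((-⌊z.1⌋ : ℤ) : ℝ) z) ∈ u ×ˢ v := by
    refine ⟨hu01 ⟨?_, ?_⟩, hball ?_⟩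
    · simpa using Int.floor_le z.1
    · have := Int.lt_floor_add_one z.1
      simp only [shift_fst, Int.cast_neg]
      linarith
    · rw [Metric.mem_ball, Subtype.dist_eq, Real.dist_eq, shift_snd]
      linarith
  have h3 : (shift ((-⌊z.1⌋ : ℤ) : ℝ) z).1 + 1 < (F^[N] (shift ((-⌊z.1⌋ : ℤ) : ℝ) z)).1 := huv h2
  rw [← coe_pow_eq_iterate, h1, shift_fst, shift_fst] at h3
  linarith

/-! ### Reflection, and the exclusion of hair sets -/

/-- The reflection of the strip that exchanges the boundary lines. -/
def reflect : Strip ≃ₜ Strip := (Homeomorph.refl _).prodCongr unitInterval.symmHomeomorph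

@[simp] theorem reflect_fst (z : Strip) : (reflect z).1 = z.1 := rfl

@[simp] theorem reflect_snd (z : Strip) : (reflect z).2 = unitInterval.symm z.2 := rfl

@[simp] theorem reflect_reflect (z : Strip) : reflect (reflect z) = z := Prod.ext rfl (by simp)

theorem reflect_inv_apply (z : Strip) : reflect⁻¹ z = reflect z :=
  reflect.injective ((reflect.apply_symm_apply z).trans (reflect_reflect z).symm)

theorem conj_reflect_apply (F : Strip ≃ₜ Strip) (z : Strip) :
    (reflect * F * reflect⁻¹) z = reflect (F (reflect z)) := by
  rw [Homeomorph.mul_apply, Homeomorph.mul_apply, reflect_inv_apply]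

theorem IsTransitive.conj_reflect {F : Strip ≃ₜ Strip} (hF : IsTransitive F) :
    IsTransitive (reflect * F * reflect⁻¹) := by
  obtain ⟨z, hz⟩ := hF
  refine ⟨reflect z, ?_⟩
  have := reflect.surjective.denseRange.dense_image reflect.continuous hz
  rw [← Set.range_comp] at this
  convert this using 3 with n
  rw [conj_zpow, conj_reflect_apply, reflect_reflect, Function.comp_apply]

theorem IsHairSet.conj_reflect {F : Strip ≃ₜ Strip} {D : Set Strip} (hD : IsHairSet F D) :
    IsHairSet (reflect * F * reflect⁻¹) (reflect '' D) where
  isClosed := reflect.isClosedMap _ hD.isClosed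
  nonempty := hD.nonempty.image _
  image_eq := by
    rw [← Set.image_comp]
    conv_rhs => rw [← hD.image_eq, ← Set.image_comp]
    refine Set.image_congr fun z _ => ?_
    rw [Function.comp_apply, conj_reflect_apply, reflect_reflect, Function.comp_apply]
  exists_hair := by
    rintro _ ⟨z, hz, rfl⟩
    obtain ⟨Γ, hΓD, hΓ, hzΓ, hleft⟩ := hD.exists_hair z hz
    refine ⟨reflect '' Γ, Set.image_mono hΓD, hΓ.image _ reflect.continuous.continuousOn,
      ⟨z, hzΓ, rfl⟩, fun M => ?_⟩
    obtain ⟨q, hq, hqM⟩ := hleft M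
    exact ⟨_, ⟨q, hq, rfl⟩, hqM⟩
  ne_zero := by
    rintro _ ⟨z, hz, rfl⟩ h
    exact hD.ne_one z hz (by simpa using h)
  ne_one := by
    rintro _ ⟨z, hz, rfl⟩ h
    exact hD.ne_zero z hz (by simpa using h)

/-- A transitive lift with positive boundary rotation numbers has no hair set. -/
theorem not_isHairSet {F : Strip ≃ₜ Strip} (htrans : IsTransitive F)
    (hT : ∀ z, F (translate z) = translate (F z))
    (hbot : ∀ z, (F z).2 = 0 ↔ z.2 = 0) (htop : ∀ z, (F z).2 = 1 ↔ z.2 = 1) {ρ₀ ρ₁ : ℝ}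
    (h₀ : HasBoundaryRotationNumber F 0 ρ₀) (hρ₀ : 0 < ρ₀)
    (h₁ : HasBoundaryRotationNumber F 1 ρ₁) (hρ₁ : 0 < ρ₁) (D : Set Strip) : ¬ IsHairSet F D := by
  intro hD
  obtain ⟨N₀, hN₀, δ₀, hδ₀, hm₀⟩ := h₀.exists_move_right hρ₀ hT hbot
  obtain ⟨N₁, hN₁, δ₁, hδ₁, hm₁⟩ := h₁.exists_move_right hρ₁ hT htop
  obtain ⟨z, hz, hlt | hlt⟩ :=
    hD.exists_near_boundary htrans hT hbot htop (lt_min hδ₀ hδ₁)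
  · have := hD.lt_snd htrans hbot hN₀ hδ₀.le (fun w hw => hm₀ w (by
      simpa [abs_of_nonneg w.2.2.1] using hw)) hz
    linarith [min_le_left δ₀ δ₁]
  -- Reflection turns the top line into the bottom line without changing first coordinates, so the
  -- bottom estimate applies to the conjugate.
  · have := hD.conj_reflect.lt_snd htrans.conj_reflect (fun w => by
        rw [conj_reflect_apply, reflect_snd, unitInterval.symm_eq_zero, htop, reflect_snd,
          unitInterval.symm_eq_one]) hN₁ hδ₁.le (fun w hw => by
        rw [conj_pow, conj_reflect_apply, reflect_fst]
        refine hm₁ (reflect w) ?_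
        simpa [abs_of_nonneg w.2.2.1] using hw) ⟨z, hz, rfl⟩
    rw [reflect_snd, unitInterval.coe_symm_eq] at this
    linarith [min_le_right δ₀ δ₁]

/-! ### Invariance properties of `B` and `B⁻` -/

theorem IsLift.snd_eq_iff {f : Annulus ≃ₜ Annulus} {F : Strip ≃ₜ Strip} (hF : IsLift f F)
    {i : unitInterval} (hi : f '' {z : Annulus | z.2 = i} = {z : Annulus | z.2 = i}) (z : Strip) :
    (F z).2 = i ↔ z.2 = i := by
  have h1 : (F z).2 = (f (proj z)).2 := congrArg Prod.snd (hF z)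
  have h2 : f (proj z) ∈ {z : Annulus | z.2 = i} ↔ proj z ∈ {z : Annulus | z.2 = i} := by
    conv_lhs => rw [← hi]
    exact f.injective.mem_set_image
  rw [h1]
  exact h2

/-- Bounded subsets of the strip have compact closure, so the inverse homeomorphism keeps them
bounded. -/
theorem not_isBounded_image (F : Strip ≃ₜ Strip) {s : Set Strip} (hs : ¬ Bornology.IsBounded s) :
    ¬ Bornology.IsBounded (F '' s) := by
  intro h
  refine hs (((h.isCompact_closure.image F.symm.continuous).isBounded).subset ?_)
  intro z hz
  exact ⟨F z, subset_closure ⟨z, hz, rfl⟩, F.symm_apply_apply z⟩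

theorem mem_setB {F : Strip ≃ₜ Strip} {z : Strip} : z ∈ setB F ↔ ∀ m, (F^[m] z).1 ≤ 0 :=
  Set.mem_iInter

theorem isClosed_setB (F : Strip ≃ₜ Strip) : IsClosed (setB F) :=
  isClosed_iInter fun m =>
    (isClosed_le continuous_fst continuous_const).preimage (F.continuous.iterate m)

theorem setB_subset_leftHalf (F : Strip ≃ₜ Strip) : setB F ⊆ leftHalf := fun _ hz =>
  mem_setB.1 hz 0

theorem image_setB_subset (F : Strip ≃ₜ Strip) : F '' setB F ⊆ setB F := by
  rintro _ ⟨z, hz, rfl⟩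
  exact mem_setB.2 fun m => mem_setB.1 hz (m + 1)

/-- Points of a boundary line with positive rotation number tend to `+∞` and leave the left half. -/
theorem HasBoundaryRotationNumber.snd_ne {F : Strip ≃ₜ Strip} {i : unitInterval} {ρ : ℝ}
    (h : HasBoundaryRotationNumber F i ρ) (hρ : 0 < ρ) {z : Strip} (hz : z ∈ setB F) :
    z.2 ≠ i := by
  rintro rfl
  obtain ⟨n, hn⟩ := ((h.tendsto_atTop hρ z.1).eventually_gt_atTop 0).exists
  exact not_lt.2 (mem_setB.1 hz n) hn

theorem mem_setBminus_of_isPreconnected {F : Strip ≃ₜ Strip} {C : Set Strip} (hC : IsPreconnected C)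
    (hCB : C ⊆ setB F) (hb : ¬ Bornology.IsBounded C) {z : Strip} (hz : z ∈ C) :
    z ∈ setBminus F :=
  ⟨hCB hz, fun h => hb (h.subset (hC.subset_connectedComponentIn hz hCB))⟩

theorem connectedComponentIn_subset_setBminus {F : Strip ≃ₜ Strip} {z : Strip}
    (hz : z ∈ setBminus F) : connectedComponentIn (setB F) z ⊆ setBminus F := fun _ hw =>
  mem_setBminus_of_isPreconnected isPreconnected_connectedComponentIn
    (connectedComponentIn_subset _ _) hz.2 hw

theorem map_mem_setBminus {F : Strip ≃ₜ Strip} {z : Strip} (hz : z ∈ setBminus F) :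
    F z ∈ setBminus F :=
  mem_setBminus_of_isPreconnected
    (isPreconnected_connectedComponentIn.image _ F.continuous.continuousOn)
    ((Set.image_mono (connectedComponentIn_subset _ _)).trans (image_setB_subset F))
    (not_isBounded_image F hz.2) ⟨z, mem_connectedComponentIn hz.1, rfl⟩

theorem iterate_mem_setBminus {F : Strip ≃ₜ Strip} {z : Strip} (hz : z ∈ setBminus F) (n : ℕ) :
    F^[n] z ∈ setBminus F := by
  induction n with
  | zero => exact hz
  | succ n ih => rw [Function.iterate_succ_apply']; exact map_mem_setBminus ih

/-! ### Full orbits in the left half, and the uniform iterate -/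

/-- The points whose whole orbit stays in the left half strip. -/
def fullB (F : Strip ≃ₜ Strip) : Set Strip := ⋂ n : ℕ, ⇑(F ^ n) '' setB F

theorem antitone_image_setB (F : Strip ≃ₜ Strip) : Antitone fun n : ℕ => ⇑(F ^ n) '' setB F :=
  antitone_nat_of_succ_le fun n => by
    have : ⇑(F ^ (n + 1)) '' setB F = ⇑(F ^ n) '' (F '' setB F) := by
      rw [pow_succ, ← Set.image_comp]
      rfl
    rw [this]
    exact Set.image_mono (image_setB_subset F)

theorem isClosed_image_setB (F : Strip ≃ₜ Strip) (n : ℕ) : IsClosed (⇑(F ^ n) '' setB F) :=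
  (F ^ n).isClosedMap _ (isClosed_setB F)

theorem image_setB_subset_setB (F : Strip ≃ₜ Strip) (n : ℕ) : ⇑(F ^ n) '' setB F ⊆ setB F := by
  simpa using antitone_image_setB F n.zero_le |>.trans (Set.image_id (setB F)).le

theorem fullB_subset_setB (F : Strip ≃ₜ Strip) : fullB F ⊆ setB F :=
  (Set.iInter_subset _ 0).trans (image_setB_subset_setB F 0)

theorem image_fullB (F : Strip ≃ₜ Strip) : F '' fullB F = fullB F := by
  rw [fullB, Set.image_iInter F.bijective]
  have : ∀ n : ℕ, F '' (⇑(F ^ n) '' setB F) = ⇑(F ^ (n + 1)) '' setB F := fun n => by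
    rw [pow_succ', ← Set.image_comp]
    rfl
  simp_rw [this]
  refine le_antisymm (le_iInf fun n => ?_) (le_iInf fun n => iInf_le _ (n + 1))
  exact (iInf_le _ n).trans (antitone_image_setB F n.le_succ)

/-- If some component of the set of full orbits in the left half strip is unbounded, then the
union of all such components is a hair set. -/
theorem isHairSet_unbounded_components {F : Strip ≃ₜ Strip} (h0 : ∀ z ∈ setB F, z.2 ≠ 0)
    (h1 : ∀ z ∈ setB F, z.2 ≠ 1)
    (hne : {z ∈ fullB F | ¬ Bornology.IsBounded (connectedComponentIn (fullB F) z)}.Nonempty) :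
    IsHairSet F {z ∈ fullB F | ¬ Bornology.IsBounded (connectedComponentIn (fullB F) z)} where
  isClosed := by
    refine isClosed_of_closure_subset fun w hw => ?_
    obtain ⟨u, hu, hlim⟩ := mem_closure_iff_seq_limit.1 hw
    -- The limit lemma for the constant sequence `fullB` says that unboundedness of the component is
    -- a closed condition.
    have := not_isBounded_connectedComponentIn_of_mapClusterPt (A := fun _ => fullB F)
      (Γ := fun n => connectedComponentIn (fullB F) (u n)) (u := u) (w := w) antitone_const
      (fun _ => isClosed_iInter (isClosed_image_setB F))
      (fun _ => (fullB_subset_setB F).trans (setB_subset_leftHalf F))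
      (fun _ => isPreconnected_connectedComponentIn) (fun _ => connectedComponentIn_subset _ _)
      (fun n => (hu n).2) (fun n => mem_connectedComponentIn (hu n).1) hlim.mapClusterPt
    rwa [Set.iInter_const] at this
  nonempty := hne
  image_eq := by
    have key : ∀ z ∈ fullB F, F '' connectedComponentIn (fullB F) z =
        connectedComponentIn (fullB F) (F z) := fun z hz => by
      rw [F.image_connectedComponentIn hz, image_fullB]
    have hsymm : ∀ s : Set Strip, F.symm '' (F '' s) = s := F.symm_image_image
    ext w
    constructor
    · rintro ⟨z, ⟨hz, hzb⟩, rfl⟩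
      refine ⟨image_fullB F ▸ ⟨z, hz, rfl⟩, ?_⟩
      rw [← key z hz]
      exact not_isBounded_image F hzb
    · rintro ⟨hw, hwb⟩
      rw [← image_fullB F] at hw
      obtain ⟨z, hz, rfl⟩ := hw
      refine ⟨z, ⟨hz, ?_⟩, rfl⟩
      rw [← key z hz] at hwb
      have := not_isBounded_image F.symm hwb
      rwa [hsymm] at this
  exists_hair := by
    rintro z ⟨hz, hzb⟩
    refine ⟨connectedComponentIn (fullB F) z, fun w hw => ⟨connectedComponentIn_subset _ _ hw, ?_⟩,
      isPreconnected_connectedComponentIn, mem_connectedComponentIn hz, exists_fst_lt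
        ((connectedComponentIn_subset _ _).trans
          ((fullB_subset_setB F).trans (setB_subset_leftHalf F))) hzb⟩
    rwa [← connectedComponentIn_eq hw]
  ne_zero := fun z hz => h0 z (fullB_subset_setB F hz.1)
  ne_one := fun z hz => h1 z (fullB_subset_setB F hz.1)

/-- Without hair sets, some iterate moves the whole of `B⁻` to the left of `-1`. -/
theorem exists_pow_lt_neg_one {F : Strip ≃ₜ Strip} (h0 : ∀ z ∈ setB F, z.2 ≠ 0)
    (h1 : ∀ z ∈ setB F, z.2 ≠ 1) (hno : ∀ D, ¬ IsHairSet F D) :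
    ∃ N : ℕ, 0 < N ∧ ∀ z ∈ setBminus F, (F^[N] z).1 < -1 := by
  by_contra! hcon
  -- The exponent `n + 1` respects `0 < N`; the images of the components of `z n` then lie in
  -- `F^(n+1)(B)`, hence in `F^n(B)`.
  choose z hz hz1 using fun n : ℕ => hcon (n + 1) n.succ_pos
  obtain ⟨w, -, hw⟩ := (isCompact_inter_Icc (isClosed_setB F) (-1) 0).exists_mapClusterPt
    (f := atTop) (u := fun n => F^[n + 1] (z n))
    (tendsto_principal.2 (Eventually.of_forall fun n =>
      ⟨(iterate_mem_setBminus (hz n) (n + 1)).1, hz1 n, mem_setB.1 (hz n).1 (n + 1)⟩))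
  have := not_isBounded_connectedComponentIn_of_mapClusterPt
    (A := fun n : ℕ => ⇑(F ^ n) '' setB F)
    (Γ := fun n => ⇑(F ^ (n + 1)) '' connectedComponentIn (setB F) (z n))
    (antitone_image_setB F) (isClosed_image_setB F)
    (fun n => (image_setB_subset_setB F n).trans (setB_subset_leftHalf F))
    (fun n => isPreconnected_connectedComponentIn.image _ (F ^ (n + 1)).continuous.continuousOn)
    (fun n => (Set.image_mono (connectedComponentIn_subset _ _)).trans
      (antitone_image_setB F n.le_succ))
    (fun n => not_isBounded_image _ (hz n).2)
    (fun n => ⟨z n, mem_connectedComponentIn (hz n).1, by rw [coe_pow_eq_iterate]⟩) hw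
  exact hno _ (isHairSet_unbounded_components h0 h1 ⟨w, this⟩)

/-! ### Linear drift and the theorem -/

/-- The linear drift to the left of the points of `B⁻`. -/
theorem fst_iterate_le {F : Strip ≃ₜ Strip} (hT : ∀ z, F (translate z) = translate (F z)) {N : ℕ}
    (hN : ∀ z ∈ setBminus F, (F^[N] z).1 < -1) (k r : ℕ) :
    ∀ z ∈ setBminus F, (F^[r + N * k] z).1 ≤ -k := by
  -- The whole component of `z` lies in `B⁻`, as do its forward images, so at every later time `F^N`
  -- has gained more than one unit; translating back by one keeps the image of the component inside
  -- `B`.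
  have hstep : ∀ z ∈ setBminus F, translate (F^[N] z) ∈ setBminus F := by
    intro z hz
    have htr : ∀ w : Strip, shift 1 w = translate w := fun w => rfl
    refine mem_setBminus_of_isPreconnected
      (C := shift 1 '' (⇑(F ^ N) '' connectedComponentIn (setB F) z))
      ((isPreconnected_connectedComponentIn.image _ (F ^ N).continuous.continuousOn).image _
        (shift 1).continuous.continuousOn) ?_ (not_isBounded_image _ (not_isBounded_image _ hz.2))
      ⟨_, ⟨z, mem_connectedComponentIn hz.1, rfl⟩, by rw [htr, coe_pow_eq_iterate]⟩
    rintro _ ⟨_, ⟨w, hw, rfl⟩, rfl⟩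
    refine mem_setB.2 fun m => ?_
    have hwm := hN _ (iterate_mem_setBminus (connectedComponentIn_subset_setBminus hz hw) m)
    rw [htr, iterate_translate hT, coe_pow_eq_iterate, ← Function.iterate_add_apply, add_comm,
      Function.iterate_add_apply]
    simp only [translate]
    linarith
  induction k with
  | zero => exact fun z hz => by simpa using mem_setB.1 hz.1 r
  | succ k ih =>
    intro z hz
    have h1 := ih _ (hstep z hz)
    rw [iterate_translate hT, ← Function.iterate_add_apply] at h1
    simp only [translate] at h1
    rw [show r + N * (k + 1) = r + N * k + N by ring]
    push_cast
    linarith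

end AnnulusLift

theorem theorem3
    (f : AnnulusLift.Annulus ≃ₜ AnnulusLift.Annulus)
    (hbd : AnnulusLift.PreservesBoundaryComponents f)
    (hor : AnnulusLift.PreservesOrientation f)
    (F : AnnulusLift.Strip ≃ₜ AnnulusLift.Strip)
    (hF : AnnulusLift.IsLift f F)
    (htrans : AnnulusLift.IsTransitive F)
    (ρ₀ ρ₁ : ℝ)
    (h₀ : AnnulusLift.HasBoundaryRotationNumber F 0 ρ₀) (hρ₀ : 0 < ρ₀)
    (h₁ : AnnulusLift.HasBoundaryRotationNumber F 1 ρ₁) (hρ₁ : 0 < ρ₁) :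
    ∃ ρ : ℝ, ρ < 0 ∧ ∀ z ∈ AnnulusLift.setBminus F,
      limsup (fun n : ℕ => ((((F^[n] z).1 - z.1) / (n : ℝ) : ℝ) : EReal)) atTop ≤ (ρ : EReal) := by
  have hT := hor F hF
  obtain ⟨N, hN, hlt⟩ := AnnulusLift.exists_pow_lt_neg_one
    (fun _ hz => h₀.snd_ne hρ₀ hz) (fun _ hz => h₁.snd_ne hρ₁ hz)
    (AnnulusLift.not_isHairSet htrans hT (hF.snd_eq_iff hbd.1) (hF.snd_eq_iff hbd.2)
      h₀ hρ₀ h₁ hρ₁)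
  have hN' : (0 : ℝ) < N := by exact_mod_cast hN
  -- The drift gives `-⌊n/N⌋ - z.1 < -n/N + 1 - z.1`. Half of the rate `1/N` is given up to absorb
  -- the constant `1 - z.1` once `n ≥ 2N(1 - z.1)`.
  refine ⟨-(1 / (2 * N)), neg_lt_zero.2 (by positivity), fun z hz => ?_⟩
  refine limsup_le_of_le (h := ?_)
  filter_upwards [eventually_gt_atTop 0,
    (tendsto_natCast_atTop_atTop (R := ℝ)).eventually_ge_atTop (2 * N * (1 - z.1))] with n hn hnz
  have hn' : (0 : ℝ) < n := by exact_mod_cast hn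
  rw [EReal.coe_le_coe_iff, div_le_iff₀ hn']
  have hdrift := AnnulusLift.fst_iterate_le hT hlt (n / N) (n % N) z hz
  rw [Nat.mod_add_div] at hdrift
  have hdiv : (n : ℝ) / N < (n / N : ℕ) + 1 := by
    rw [div_lt_iff₀ hN']
    have hlt' : n < (n / N + 1) * N := by
      linarith [Nat.div_add_mod' n N, Nat.mod_lt n hN]
    exact_mod_cast hlt'
  have hhalf : 1 - z.1 ≤ (n : ℝ) / N / 2 := by
    rw [div_div, le_div_iff₀ (by positivity)]
    linarith
  have heq : -(1 / (2 * (N : ℝ))) * n = -((n : ℝ) / N / 2) := by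
    field_simp
  rw [heq]
  linarith
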